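/- Fix a field $\mathbf k$ and integers $1\le r\le d$. Simplicial complexes are finite and contain the empty face. For a simplicial complex $\Delta$ of dimension $d-1$: - $\Delta$ is a *homology $(d-1)$-sphere* (over $\mathbf k$) if $\widetilde H_*(\mathrm{lk}_\Delta(F);\mathbf k)\cong\widetilde H_*(\mathbb S^{d-|F|-1};\mathbf k)$ for every face $F$ (including $\emptyset$); it is a *closed homology $(d-1)$-manifold* if this holds for every nonempty face. - $\Delta$ is *balanced* if it is equipped with a vertex colouring $\kappa$ by $[d]=\{1,\dots,d\}$ such that no face contains two vertices of the same colour. - For $S\subseteq[d]$ (or for a larger colour set), $f_S(\Delta)$ is the number of faces $F\in\Delta$ with $\kappa(F)=S$, and $h_T(\Delta)=\sum_{S\subseteq T}(-1)^{|T|-|S|}f_S(\Delta)$. A *$d$-dimensional cross-polytopal complex* is a (finite) $d$-dimensional regular CW complex $\mathcal X$ whose $(d-1)$-skeleton is a simplicial complex, such that the boundary of each $d$-cell is (a copy of) the boundary complex of the $d$-dimensional cross-polytope, i.e. the complex with $2d$ distinct vertices $u_1,v_1,\dots,u_d,v_d$ whose faces are all vertex sets containing no pair $\{u_i,v_i\}$,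 and such that no two $d$-cells have the same vertex set. If $\mathcal Y$ is such a complex or a $d$-dimensional simplicial complex, its *boundary complex* $\partial\mathcal Y$ consists of $\emptyset$ and all nonempty faces $F$ with $H_*(\|\mathcal Y\|,\|\mathcal Y\|-p;\mathbf k)=0$ for $p$ in the relative interior of $F$. $\mathcal X$ is a *homology $d$-ball* if for every $p\in\|\mathcal X\|$ the pair $(\|\mathcal X\|,\|\mathcal X\|-p)$ has, over $\mathbf k$, either vanishing relative homology or that of a $d$-sphere (one copy of $\mathbf k$, in degree $d$), if $\widetilde H_*(\|\mathcal X\|;\mathbf k)=0$, and if $\partial\mathcal X$ is a homology $(d-1)$-sphere. Let $\Delta$ be a balanced homology $(d-1)$-sphere over $\mathbf k$, and let $\mathcal X$ be an *$(r-1)$-stacked cross-polytopal decomposition* of $\Delta$, that is, a $d$-dimensional cross-polytopal complex that is a homology $d$-ball over $\mathbf k$ with $\partial\mathcal X=\Delta$ and all of whose faces of dimension at most $d-r$ are faces of $\Delta$. Let $m$ be the number of $d$-cells $C_1,\dots,C_m$ of $\mathcal X$, and let $\Gamma$ be the simplicial complex obtained from $\mathcal X$ by replacing each $C_i$ by the cone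 over its boundary with a new apex $b_i$; colour the vertices of $\Gamma$ by giving those of $\Delta$ their colours and all the $b_i$ the new colour $d+1$. **Theorem.** For every $T\subseteq[d]$ with $r-1\le|T|\le d-r+1$, $$h_T(\Delta)=h_T(\partial\Gamma)=m .$$ -/

import Mathlib

open Finset

universe u v

/-- A finite abstract simplicial complex with vertices in `V`; the empty set is a face. -/
@[ext]
structure FinComplex (V : Type u) where
  faces : Finset (Finset V)
  empty_mem : ∅ ∈ faces
  down_closed : ∀ F ∈ faces, ∀ G, G ⊆ F → G ∈ faces

section Homology

variable {V : Type u}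

/-- The coefficient of `G` in the boundary of the simplex `F`, each simplex being oriented by a fixed
well-order of the type of all vertices: it is `(-1)^j` if `G` arises from `F` by deleting the vertex
that has exactly `j` predecessors in `F`, and it is `0` if `G` is not of this form. -/
noncomputable def incidence (F G : Finset V) : ℤ := by
  classical
  exact ∑ v ∈ F, if F.erase v = G then (-1) ^ #{w ∈ F | WellOrderingRel w v} else 0

/-- The members of cardinality `n`, that is, of dimension `n - 1`, of a family of faces. -/
def facesOfCard (A : Finset (Finset V)) (n : ℕ) : Finset (Finset V) := {F ∈ A | #F = n}

/-- The simplicial boundary map from chains on the faces in `A` with `n + 1` vertices to chains on the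
faces in `A` with `n` vertices. -/
noncomputable def boundaryMap (k : Type v) [Field k] (A : Finset (Finset V)) (n : ℕ) :
    (facesOfCard A (n + 1) → k) →ₗ[k] (facesOfCard A n → k) :=
  Matrix.mulVecLin (Matrix.of fun G F => ((incidence F.1 G.1 : ℤ) : k))

/-- Cycles on the faces in `A` with `n` vertices. -/
noncomputable def cycles (k : Type v) [Field k] (A : Finset (Finset V)) :
    (n : ℕ) → Submodule k (facesOfCard A n → k)
  | 0 => ⊤
  | n + 1 => LinearMap.ker (boundaryMap k A n)

/-- Simplicial homology in dimension `n - 1` with coefficients in `k` of the chain complex spanned by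
a family `A` of faces. If `A` is the set of all faces (with the empty one) of a simplicial complex, this
is its reduced homology; if `A = K \ L` for a complex `K` and a subcomplex `L` with `∅ ∈ L`, it is the
relative homology of the pair `(K, L)`. -/
abbrev Homology (k : Type v) [Field k] (A : Finset (Finset V)) (n : ℕ) : Type (max u v) :=
  cycles k A n ⧸ (LinearMap.range (boundaryMap k A n)).submoduleOf (cycles k A n)

/-- All the homology of `A` vanishes. -/
def IsAcyclic (k : Type v) [Field k] (A : Finset (Finset V)) : Prop :=
  ∀ n, Module.finrank k (Homology k A n) = 0

/-- The homology of `A` is one-dimensional in dimension `s - 1` and vanishes in all others. -/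
def HasSphereHomology (k : Type v) [Field k] (A : Finset (Finset V)) (s : ℕ) : Prop :=
  ∀ n, Module.finrank k (Homology k A n) = if n = s then 1 else 0

end Homology

namespace FinComplex

variable {V : Type u}

/-- `K` has dimension `d - 1`. -/
def HasDimPred (K : FinComplex V) (d : ℕ) : Prop :=
  (∃ F ∈ K.faces, #F = d) ∧ ∀ F ∈ K.faces, #F ≤ d

/-- The vertex set of `K`. -/
def vertices (K : FinComplex V) : Set V := {x | {x} ∈ K.faces}

/-- The faces of the link of `F` in `K`. -/
noncomputable def link (K : FinComplex V) (F : Finset V) : Finset (Finset V) := by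
  classical
  exact {G ∈ K.faces | Disjoint F G ∧ F ∪ G ∈ K.faces}

/-- The faces of `K` that contain `F`, i.e. those of `K` that are not in the subcomplex of all faces not
containing `F`. For `F` nonempty and `p` in the relative interior of `F`, the realization of this
subcomplex is a deformation retract of `‖K‖ - p`, so that the homology of this family of faces is
`H_*(‖K‖, ‖K‖ - p)`. -/
noncomputable def openStar (K : FinComplex V) (F : Finset V) : Finset (Finset V) := by
  classical
  exact {G ∈ K.faces | F ⊆ G}

/-- `K` is a homology `(d-1)`-sphere over `k`. -/
def IsHomologySphere (k : Type v) [Field k] (K : FinComplex V) (d : ℕ) : Prop :=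
  K.HasDimPred d ∧ ∀ F ∈ K.faces, HasSphereHomology k (K.link F) (d - #F)

/-- `K` is a closed homology `(d-1)`-manifold over `k`. -/
def IsClosedHomologyManifold (k : Type v) [Field k] (K : FinComplex V) (d : ℕ) : Prop :=
  K.HasDimPred d ∧ ∀ F ∈ K.faces, F ≠ ∅ → HasSphereHomology k (K.link F) (d - #F)

/-- The boundary complex of `K`: the empty face and all nonempty faces `F` such that
`H_*(‖K‖, ‖K‖ - p; k) = 0` for `p` in the relative interior of `F`. -/
noncomputable def boundaryFaces (k : Type v) [Field k] (K : FinComplex V) : Finset (Finset V) := by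
  classical
  exact {F ∈ K.faces | F = ∅ ∨ IsAcyclic k (K.openStar F)}

/-- `K` is a `(d-1)`-dimensional complex, and `κ` is a proper colouring of it with `d` colours. -/
def IsBalanced {d : ℕ} (K : FinComplex V) (κ : V → Fin d) : Prop :=
  K.HasDimPred d ∧ ∀ F ∈ K.faces, Set.InjOn κ F

/-- `K` is a copy in `V` of the boundary complex of the `d`-dimensional cross-polytope: its vertices are
the `2 d` distinct points `φ (i, true)`, `φ (i, false)`, and its faces are all sets of vertices that do
not contain an antipodal pair. -/
def IsCrossPolytope (K : FinComplex V) (d : ℕ) : Prop :=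
  ∃ φ : Fin d × Bool ↪ V, ∀ F : Finset V, F ∈ K.faces ↔
    ∃ G : Finset (Fin d × Bool), (∀ i, ¬((i, true) ∈ G ∧ (i, false) ∈ G)) ∧ G.map φ = F

end FinComplex

/-- The flag `f`-number: the number of faces in `A` whose set of colours is `S`. -/
def flagF {V : Type u} {d : ℕ} (A : Finset (Finset V)) (κ : V → Fin d) (S : Finset (Fin d)) : ℕ :=
  #{F ∈ A | F.image κ = S}

/-- The flag `h`-number `h_T = ∑_{S ⊆ T} (-1)^(|T| - |S|) f_S`. -/
def flagH {V : Type u} {d : ℕ} (A : Finset (Finset V)) (κ : V → Fin d) (T : Finset (Fin d)) : ℤ :=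
  ∑ S ∈ T.powerset, (-1) ^ (#T - #S) * (flagF A κ S : ℤ)

/-- A `d`-dimensional cross-polytopal complex: a regular CW complex whose `(d-1)`-skeleton is a
simplicial complex `skel`, such that the boundary of each `d`-cell is a subcomplex of `skel` isomorphic
to the boundary of the cross-polytope, and no two `d`-cells have the same vertex set. A `d`-cell is
recorded by its boundary complex, which determines it. -/
structure CrossPolytopalComplex (V : Type u) (d : ℕ) where
  skel : FinComplex V
  skel_dim : ∀ F ∈ skel.faces, #F ≤ d
  cells : Finset (FinComplex V)
  cells_nonempty : cells.Nonempty
  cell_subset : ∀ C ∈ cells, C.faces ⊆ skel.faces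
  cell_crossPolytope : ∀ C ∈ cells, C.IsCrossPolytope d
  cell_eq : ∀ C ∈ cells, ∀ C' ∈ cells, C.vertices = C'.vertices → C = C'

namespace CrossPolytopalComplex

variable {V : Type u} {d : ℕ}

/-- A simplicial face of `X`, regarded as a face of the stellar subdivision. -/
def oldFace (X : CrossPolytopalComplex V d) (F : Finset V) : Finset (V ⊕ X.cells) :=
  F.map Function.Embedding.inl

/-- The cone over the boundary face `F` of the `d`-cell `C`, with the new vertex of `C` as its apex. -/
def coneFace (X : CrossPolytopalComplex V d) (C : X.cells) (F : Finset V) : Finset (V ⊕ X.cells) :=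
  Finset.cons (Sum.inr C) (X.oldFace F) (by simp [oldFace])

/-- The stellar subdivision `Γ` of `X`: each `d`-cell `C` is replaced by the cone over its boundary,
with a new vertex as apex. -/
noncomputable def stellar (X : CrossPolytopalComplex V d) : FinComplex (V ⊕ X.cells) where
  faces := by
    classical
    exact X.skel.faces.image X.oldFace ∪
      Finset.univ.biUnion fun C : X.cells => C.1.faces.image (X.coneFace C)
  empty_mem := by
    classical
    exact mem_union_left _ (mem_image.2 ⟨∅, X.skel.empty_mem, by simp [oldFace]⟩)
  down_closed := by
    classical
    intro F hF G hGF
    have key : ∀ G : Finset (V ⊕ X.cells), (∀ C, Sum.inr C ∉ G) → G = X.oldFace G.toLeft := by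
      intro G hG
      ext (x | x) <;> simp [oldFace, hG]
    simp only [mem_union, mem_image, mem_biUnion, mem_univ, true_and] at hF ⊢
    rcases hF with ⟨F, hF, rfl⟩ | ⟨C, F, hF, rfl⟩
    · refine Or.inl ⟨G.toLeft, X.skel.down_closed F hF _ ?_, (key G ?_).symm⟩
      · intro x hx
        have := hGF (mem_toLeft.1 hx)
        simpa [oldFace] using this
      · intro C hC
        have := hGF hC
        simp [oldFace] at this
    · have hsub : G.toLeft ⊆ F := by
        intro x hx
        have := hGF (mem_toLeft.1 hx)
        simpa [oldFace, coneFace] using this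
      have hr : ∀ C', Sum.inr C' ∈ G → C' = C := by
        intro C' hC'
        have := hGF hC'
        simpa [oldFace, coneFace] using this
      by_cases hC : Sum.inr C ∈ G
      · refine Or.inr ⟨C, G.toLeft, C.1.down_closed F hF _ hsub, ?_⟩
        ext (x | x)
        · simp [oldFace, coneFace]
        · simp only [coneFace, oldFace, mem_cons, mem_map, Sum.inr.injEq]
          constructor
          · rintro (rfl | ⟨y, -, hy⟩)
            · exact hC
            · simp at hy
          · exact fun h => Or.inl (hr x h)
      · refine Or.inl ⟨G.toLeft, X.skel.down_closed F (X.cell_subset C.1 C.2 hF) _ hsub,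
          (key G ?_).symm⟩
        intro C' hC'
        exact hC (hr C' hC' ▸ hC')

/-- The boundary complex of `X`: the empty face and all nonempty faces `F` with
`H_*(‖X‖, ‖X‖ - p; k) = 0` for `p` in the relative interior of `F`, the space `‖X‖` being triangulated
by the stellar subdivision. Points inside the `d`-cells have neighbourhoods that are open `d`-balls, so
only faces of the simplicial skeleton can occur. -/
noncomputable def boundaryFaces (k : Type v) [Field k] (X : CrossPolytopalComplex V d) :
    Finset (Finset V) := by
  classical
  exact {F ∈ X.skel.faces | F = ∅ ∨ IsAcyclic k (X.stellar.openStar (X.oldFace F))}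

/-- `X` is a `k`-homology `d`-manifold with boundary. Each point `p` of `‖X‖` lies in the relative
interior of a unique nonempty face `F` of the stellar subdivision, which triangulates `‖X‖`; the pair
`(‖X‖, ‖X‖ - p)` has to have the relative homology of a ball (none) or of a `d`-sphere. -/
def IsHomologyManifoldWithBoundary (k : Type v) [Field k] (X : CrossPolytopalComplex V d) : Prop :=
  (∀ F ∈ X.stellar.faces, F ≠ ∅ →
    IsAcyclic k (X.stellar.openStar F) ∨ HasSphereHomology k (X.stellar.openStar F) (d + 1)) ∧
  ∃ B : FinComplex V, B.faces = X.boundaryFaces k ∧ B.IsClosedHomologyManifold k d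

/-- `X` is a `k`-homology `d`-ball. -/
def IsHomologyBall (k : Type v) [Field k] (X : CrossPolytopalComplex V d) : Prop :=
  X.IsHomologyManifoldWithBoundary k ∧
  IsAcyclic k X.stellar.faces ∧
  ∃ B : FinComplex V, B.faces = X.boundaryFaces k ∧ B.IsHomologySphere k d

/-- `X` is an `(r-1)`-stacked cross-polytopal decomposition of the complex `Δ`: a homology `d`-ball with
boundary complex `Δ`, all of whose faces of dimension at most `d - r` are faces of `Δ`. -/
def IsStackedDecomposition (k : Type v) [Field k] (X : CrossPolytopalComplex V d)
    (Δ : FinComplex V) (r : ℕ) : Prop :=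
  X.IsHomologyBall k ∧ X.boundaryFaces k = Δ.faces ∧
  ∀ F ∈ X.skel.faces, #F ≤ d - r + 1 → F ∈ Δ.faces

/-- The colouring of the stellar subdivision that extends `κ` and gives all new vertices the extra last
colour. -/
def stellarColoring (X : CrossPolytopalComplex V d) (κ : V → Fin d) : V ⊕ X.cells → Fin (d + 1) :=
  Sum.elim (fun x => (κ x).castSucc) (fun _ => Fin.last d)

end CrossPolytopalComplex

/-! The proof is a double count with signs. Write χ(F) for the sum of (-1)^|G| over the faces G
containing F. In any coloured complex, summing (-1)^|F| χ(F) over the faces F with colours outside T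
gives the sum of (-1)^|G| over the faces G with colours in T (`sum_openStar_compl`).

Apply this to the skeleton of `X`, assuming that `κ` is proper there. Faces with colours in T, or in
its complement, have at most d - r + 1 vertices, so they lie in Δ by stackedness, and the right side
is h_T(Δ) up to sign. At a face F of Δ the open star in Γ is acyclic, so the Euler–Poincaré formula,
with the cones removed, gives χ(F) = (-1)^d · #{cells containing F} (`sum_openStar_skel`). After
exchanging the sums each cell contributes the same sign, because a proper d-colouring of a
cross-polytope gives antipodes equal colours (`sum_image_subset`). Hence h_T(Δ) = m.

If r < d, all edges of `X` lie in Δ and `κ` is proper; if d = 1 there are no edges. The only other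
case is r = d = 2 and |T| = 1, a polygon cut into quadrangles: it has 2m + 2 vertices, duality on Δ
makes the colour classes equal, and h_T = (m + 1) - 1.

Finally ∂Γ is a copy of Δ, since a face containing a new apex has an open star with nonzero Euler
sum (`boundaryFaces_stellar`). -/

/-! ### Simplicial chain complexes and the Euler–Poincaré formula -/

section Euler

variable {V : Type u}

open Classical in
/-- The sign with which the face opposite to `x` enters the boundary of `F`. -/
noncomputable def deletionSign (F : Finset V) (x : V) : ℤ :=
  (-1) ^ #{w ∈ F | WellOrderingRel w x}

open Classical in
theorem incidence_eq_sum (F G : Finset V) :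
    incidence F G = ∑ x ∈ F, if F.erase x = G then deletionSign F x else 0 := by
  unfold incidence deletionSign
  rfl

open Classical in
theorem deletionSign_erase_of_rel {F : Finset V} {x y : V} (hx : x ∈ F)
    (h : WellOrderingRel x y) : deletionSign (F.erase x) y = -deletionSign F y := by
  unfold deletionSign
  have hmem : x ∈ ({w ∈ F | WellOrderingRel w y} : Finset V) := by simp [hx, h]
  rw [filter_erase, ← card_erase_add_one hmem, pow_succ]
  ring

open Classical in
theorem deletionSign_erase_of_not_rel {F : Finset V} {x y : V}
    (h : ¬ WellOrderingRel x y) : deletionSign (F.erase x) y = deletionSign F y := by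
  unfold deletionSign
  rw [filter_erase, erase_eq_of_notMem (by simp [h])]

-- Deleting the smaller vertex first lowers the predecessor count of the other by one; deleting the
-- larger first changes nothing. So the two orders of deletion have opposite signs, which is the
-- source of ∂∂ = 0.
open Classical in
theorem deletionSign_mul_swap {F : Finset V} {x y : V} (hx : x ∈ F) (hy : y ∈ F) (hxy : x ≠ y) :
    deletionSign F x * deletionSign (F.erase x) y =
      -(deletionSign F y * deletionSign (F.erase y) x) := by
  rcases trichotomous_of (WellOrderingRel (α := V)) x y with h | h | h
  · rw [deletionSign_erase_of_rel hx h,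
      deletionSign_erase_of_not_rel (asymm h : ¬ WellOrderingRel y x)]
    ring
  · exact absurd h hxy
  · rw [deletionSign_erase_of_rel hy h,
      deletionSign_erase_of_not_rel (asymm h : ¬ WellOrderingRel x y)]
    ring

/-- A family of sets that contains every set lying between two of its members. -/
def IsConvexFamily (A : Finset (Finset V)) : Prop :=
  ∀ F ∈ A, ∀ H ∈ A, ∀ G, F ⊆ G → G ⊆ H → G ∈ A

open Classical in
theorem sum_incidence_mul_incidence {A : Finset (Finset V)} (hA : IsConvexFamily A) {n : ℕ}
    {F H : Finset V} (hF : F ∈ facesOfCard A (n + 2)) (hH : H ∈ facesOfCard A n) :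
    ∑ G ∈ facesOfCard A (n + 1), incidence F G * incidence G H = 0 := by
  simp only [facesOfCard, mem_filter] at hF hH
  set t : V → V → ℤ := fun x y =>
    if y ∈ F.erase x ∧ (F.erase x).erase y = H then
      deletionSign F x * deletionSign (F.erase x) y else 0 with ht
  have key : ∑ G ∈ facesOfCard A (n + 1), incidence F G * incidence G H =
      ∑ x ∈ F, ∑ y ∈ F, t x y := by
    have h1 : ∀ G ∈ facesOfCard A (n + 1), incidence F G * incidence G H =
        ∑ x ∈ F, if F.erase x = G then deletionSign F x * incidence (F.erase x) H else 0 := by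
      intro G _
      rw [incidence_eq_sum F G, sum_mul]
      refine sum_congr rfl fun x _ => ?_
      split_ifs with h
      · rw [h]
      · simp
    rw [sum_congr rfl h1, sum_comm]
    refine sum_congr rfl fun x hx => ?_
    rw [sum_ite_eq]
    have h2 : ∑ y ∈ F, t x y = deletionSign F x * incidence (F.erase x) H := by
      rw [incidence_eq_sum, mul_sum]
      rw [← sum_subset (erase_subset x F)]
      · refine sum_congr rfl fun y hy => ?_
        simp only [ht, hy, true_and, mul_ite, mul_zero]
      · intro y _ hy
        simp only [ht, hy, false_and, if_false]
    rw [h2]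
    split_ifs with h
    · rfl
    · rw [← h2]
      symm
      refine sum_eq_zero fun y _ => ?_
      simp only [ht]
      -- If some `y` led from `F.erase x` to `H`, then `F.erase x` would lie between `H` and `F`,
      -- hence in `A` by convexity.
      refine if_neg ?_
      rintro ⟨-, h'⟩
      apply h
      simp only [facesOfCard, mem_filter]
      refine ⟨hA H hH.1 F hF.1 _ ?_ (erase_subset _ _), ?_⟩
      · rw [← h']; exact erase_subset _ _
      · rw [card_erase_of_mem hx, hF.2]; rfl
  rw [key]
  have hanti : ∀ x ∈ F, ∀ y ∈ F, t x y = - t y x := by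
    intro x hx y hy
    by_cases hxy : x = y
    · subst hxy; simp [ht]
    · simp only [ht, mem_erase, hx, hy, hxy, Ne.symm hxy, ne_eq, not_false_eq_true, and_self,
        true_and]
      rw [erase_right_comm (a := y) (b := x)]
      split_ifs
      · exact deletionSign_mul_swap hx hy hxy
      · simp
  -- An antisymmetric double sum equals its own negative, so it vanishes in ℤ.
  have : ∑ x ∈ F, ∑ y ∈ F, t x y = - ∑ x ∈ F, ∑ y ∈ F, t x y := by
    conv_lhs => rw [sum_comm]
    rw [← sum_neg_distrib]
    refine sum_congr rfl fun x hx => ?_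
    rw [← sum_neg_distrib]
    exact sum_congr rfl fun y hy => hanti y hy x hx
  linarith

variable (k : Type v) [Field k]

theorem boundaryMap_comp_boundaryMap {A : Finset (Finset V)} (hA : IsConvexFamily A) (n : ℕ) :
    boundaryMap k A n ∘ₗ boundaryMap k A (n + 1) = 0 := by
  unfold boundaryMap
  rw [← Matrix.mulVecLin_mul]
  have : (Matrix.of fun (G : facesOfCard A n) (F : facesOfCard A (n + 1)) =>
        ((incidence F.1 G.1 : ℤ) : k)) *
      (Matrix.of fun (G : facesOfCard A (n + 1)) (F : facesOfCard A (n + 1 + 1)) =>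
        ((incidence F.1 G.1 : ℤ) : k)) = 0 := by
    ext H F
    have h := sum_incidence_mul_incidence hA F.2 H.2
    rw [← sum_coe_sort] at h
    have h' := congrArg (Int.cast : ℤ → k) h
    push_cast at h'
    simp only [Matrix.mul_apply, Matrix.of_apply, Matrix.zero_apply]
    rw [← h']
    exact sum_congr rfl fun G _ => mul_comm (_ : k) _
  rw [this, Matrix.mulVecLin_zero]

theorem range_boundaryMap_le_cycles {A : Finset (Finset V)} (hA : IsConvexFamily A) (n : ℕ) :
    LinearMap.range (boundaryMap k A n) ≤ cycles k A n := by
  cases n with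
  | zero => exact le_top
  | succ n => exact LinearMap.range_le_ker_iff.2 (boundaryMap_comp_boundaryMap k hA n)

theorem finrank_homology_add {A : Finset (Finset V)} (hA : IsConvexFamily A) (n : ℕ) :
    Module.finrank k (Homology k A n) + Module.finrank k (LinearMap.range (boundaryMap k A n)) =
      Module.finrank k (cycles k A n) := by
  rw [← Submodule.finrank_quotient_add_finrank
    ((LinearMap.range (boundaryMap k A n)).submoduleOf (cycles k A n)),
    (Submodule.submoduleOfEquivOfLe (range_boundaryMap_le_cycles k hA n)).finrank_eq]

/-- The Euler–Poincaré formula. -/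
theorem sum_neg_one_pow_card_eq_sum_finrank {A : Finset (Finset V)} (hA : IsConvexFamily A)
    {N : ℕ} (hN : ∀ F ∈ A, #F < N) :
    ∑ F ∈ A, (-1 : ℤ) ^ #F =
      ∑ n ∈ range N, (-1) ^ n * (Module.finrank k (Homology k A n) : ℤ) := by
  have h1 : ∑ F ∈ A, (-1 : ℤ) ^ #F = ∑ n ∈ range N, (-1) ^ n * (#(facesOfCard A n) : ℤ) := by
    rw [← sum_fiberwise_of_maps_to (g := fun F : Finset V => #F) (t := range N)
      (fun F hF => mem_range.2 (hN F hF))]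
    refine sum_congr rfl fun n _ => ?_
    rw [sum_congr rfl (g := fun _ => (-1 : ℤ) ^ n)
      (fun F hF => by rw [(mem_filter.1 hF).2])]
    rw [sum_const, facesOfCard, nsmul_eq_mul, mul_comm]
  have hdim : ∀ n, Module.finrank k (facesOfCard A n → k) = #(facesOfCard A n) := fun n => by
    rw [Module.finrank_fintype_fun_eq_card, Fintype.card_coe]
  -- The ranks telescope: truncating at `M` leaves only the rank of the boundary map that arrives in
  -- degree `M`.
  have h2 : ∀ M, ∑ n ∈ range (M + 1), (-1 : ℤ) ^ n * (#(facesOfCard A n) : ℤ) =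
      ∑ n ∈ range (M + 1), (-1) ^ n * (Module.finrank k (Homology k A n) : ℤ) +
        (-1) ^ M * (Module.finrank k (LinearMap.range (boundaryMap k A M)) : ℤ) := by
    intro M
    induction M with
    | zero =>
      have h3 : Module.finrank k (cycles k A 0) = #(facesOfCard A 0) :=
        (finrank_top k (facesOfCard A 0 → k)).trans (hdim 0)
      have := (finrank_homology_add k hA 0).trans h3
      simp only [zero_add, sum_range_one, pow_zero, one_mul]
      exact_mod_cast this.symm
    | succ M ih =>
      rw [sum_range_succ, ih, sum_range_succ _ (M + 1)]
      have h3 : Module.finrank k (Homology k A (M + 1)) +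
          Module.finrank k (LinearMap.range (boundaryMap k A (M + 1))) =
          Module.finrank k (LinearMap.ker (boundaryMap k A M)) :=
        finrank_homology_add k hA (M + 1)
      have h4 := LinearMap.finrank_range_add_finrank_ker (boundaryMap k A M)
      rw [hdim] at h4
      rw [← h4, ← h3]
      push_cast
      ring
  rw [h1]
  cases N with
  | zero => simp
  | succ M =>
    rw [h2]
    -- No face has `M + 1` vertices, so the leftover rank is zero.
    have h0 : #(facesOfCard A (M + 1)) = 0 :=
      card_eq_zero.2 (filter_eq_empty_iff.2 fun F hF => (hN F hF).ne)
    have hr : Module.finrank k (LinearMap.range (boundaryMap k A M)) = 0 := by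
      have h4 := LinearMap.finrank_range_add_finrank_ker (boundaryMap k A M)
      rw [hdim] at h4
      omega
    rw [hr]
    simp

variable {k}

theorem IsAcyclic.sum_neg_one_pow_card {A : Finset (Finset V)} (hA : IsConvexFamily A)
    (h : IsAcyclic k A) : ∑ F ∈ A, (-1 : ℤ) ^ #F = 0 := by
  rw [sum_neg_one_pow_card_eq_sum_finrank k hA (N := A.sup card + 1)
    (fun F hF => Nat.lt_succ_of_le (le_sup (f := card) hF))]
  exact sum_eq_zero fun n _ => by rw [h n]; simp

theorem HasSphereHomology.sum_neg_one_pow_card {A : Finset (Finset V)} (hA : IsConvexFamily A)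
    {s : ℕ} (h : HasSphereHomology k A s) : ∑ F ∈ A, (-1 : ℤ) ^ #F = (-1) ^ s := by
  -- The extra `s + 1` puts degree `s` inside the range of summation.
  rw [sum_neg_one_pow_card_eq_sum_finrank k hA (N := A.sup card + 1 + (s + 1))
    (fun F hF => Nat.lt_add_right _ (Nat.lt_succ_of_le (le_sup (f := card) hF)))]
  rw [sum_eq_single s]
  · rw [h s]; simp
  · intro n _ hn
    rw [h n]; simp [hn]
  · intro hs
    exact absurd (mem_range.2 (by omega)) hs

end Euler

/-! ### Euler sums of open stars -/

section Complex

variable {V : Type u}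

theorem FinComplex.isConvexFamily_faces (K : FinComplex V) : IsConvexFamily K.faces :=
  fun _ _ H hH G _ hG => K.down_closed H hH G hG

theorem FinComplex.isConvexFamily_openStar (K : FinComplex V) (F : Finset V) :
    IsConvexFamily (K.openStar F) := by
  classical
  intro F₁ h₁ H hH G hG hGH
  simp only [FinComplex.openStar, mem_filter] at *
  exact ⟨K.down_closed H hH.1 G hGH, h₁.2.trans hG⟩

theorem FinComplex.isConvexFamily_link (K : FinComplex V) (F : Finset V) :
    IsConvexFamily (K.link F) := by
  classical
  intro F₁ h₁ H hH G hG hGH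
  simp only [FinComplex.link, mem_filter] at *
  exact ⟨K.down_closed H hH.1 G hGH, hH.2.1.mono_right hGH,
    K.down_closed _ hH.2.2 _ (union_subset_union_right hGH)⟩

/-- In a homology sphere, every open star has the Euler characteristic of an open ball. -/
theorem FinComplex.IsHomologySphere.sum_openStar {k : Type v} [Field k] {K : FinComplex V} {d : ℕ}
    (hK : K.IsHomologySphere k d) {F : Finset V} (hF : F ∈ K.faces) :
    ∑ G ∈ K.openStar F, (-1 : ℤ) ^ #G = (-1) ^ d := by
  classical
  have h := (hK.2 F hF).sum_neg_one_pow_card (K.isConvexFamily_link F)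
  have hd := hK.1.2 F hF
  -- Joining with `F` maps the link bijectively onto the open star.
  have : ∑ G ∈ K.openStar F, (-1 : ℤ) ^ #G = ∑ G ∈ K.link F, (-1) ^ #F * (-1 : ℤ) ^ #G := by
    symm
    refine sum_bij' (fun G _ => F ∪ G) (fun G _ => G \ F) ?_ ?_ ?_ ?_ ?_
    · intro G hG
      simp only [FinComplex.link, FinComplex.openStar, mem_filter] at hG ⊢
      exact ⟨hG.2.2, subset_union_left⟩
    · intro G hG
      simp only [FinComplex.link, FinComplex.openStar, mem_filter] at hG ⊢
      refine ⟨K.down_closed G hG.1 _ sdiff_subset, disjoint_sdiff, ?_⟩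
      rw [union_sdiff_of_subset hG.2]; exact hG.1
    · intro G hG
      simp only [FinComplex.link, mem_filter] at hG
      exact union_sdiff_cancel_left hG.2.1
    · intro G hG
      simp only [FinComplex.openStar, mem_filter] at hG
      exact union_sdiff_of_subset hG.2
    · intro G hG
      simp only [FinComplex.link, mem_filter] at hG
      rw [card_union_of_disjoint hG.2.1, pow_add]
  rw [this, ← mul_sum, h, ← pow_add, Nat.add_sub_cancel' hd]

end Complex

/-! ### Flag numbers as signed face counts, and duality -/

section FlagNumbers

variable {V : Type u} {d : ℕ}

/-- Grouping faces by colour set suffices. The exponent counts colours, not vertices, so the formula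
needs no properness. -/
theorem flagH_eq_sum (A : Finset (Finset V)) (κ : V → Fin d) (T : Finset (Fin d)) :
    flagH A κ T = (-1) ^ #T * ∑ F ∈ A with F.image κ ⊆ T, (-1 : ℤ) ^ #(F.image κ) := by
  rw [flagH, ← sum_fiberwise_of_maps_to (g := fun F : Finset V => F.image κ) (t := T.powerset)
    (fun F hF => mem_powerset.2 (mem_filter.1 hF).2), mul_sum]
  refine sum_congr rfl fun S hS => ?_
  have hST := mem_powerset.1 hS
  rw [sum_congr rfl (g := fun _ => (-1 : ℤ) ^ #S) (fun F hF => by rw [(mem_filter.1 hF).2]),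
    sum_const, filter_filter, nsmul_eq_mul]
  have h1 : #{F ∈ A | F.image κ ⊆ T ∧ F.image κ = S} = flagF A κ S := by
    unfold flagF
    congr 1
    refine filter_congr fun F _ => ⟨fun h => h.2, fun h => ⟨h ▸ hST, h⟩⟩
  have h2 : (-1 : ℤ) ^ #T = (-1) ^ (#T - #S) * (-1) ^ #S := by
    rw [← pow_add, Nat.sub_add_cancel (card_le_card hST)]
  rw [h1, h2]
  have h3 : (-1 : ℤ) ^ #S * (-1) ^ #S = 1 := by rw [← mul_pow]; simp
  linear_combination (-(-1 : ℤ) ^ (#T - #S) * (flagF A κ S : ℤ)) * h3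

theorem flagH_eq_sum_of_injOn {A : Finset (Finset V)} {κ : V → Fin d}
    (hκ : ∀ F ∈ A, Set.InjOn κ F) (T : Finset (Fin d)) :
    flagH A κ T = (-1) ^ #T * ∑ F ∈ A with F.image κ ⊆ T, (-1 : ℤ) ^ #F := by
  rw [flagH_eq_sum]
  congr 1
  exact sum_congr rfl fun F hF => by rw [card_image_of_injOn (hκ F (mem_filter.1 hF).1)]

open Classical in
/-- The duality behind the Dehn–Sommerville relations, for an arbitrary vertex colouring. -/
theorem FinComplex.sum_openStar_compl (K : FinComplex V) (κ : V → Fin d) (T : Finset (Fin d)) :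
    ∑ F ∈ K.faces with F.image κ ⊆ Tᶜ, (-1 : ℤ) ^ #F * ∑ G ∈ K.openStar F, (-1 : ℤ) ^ #G =
      ∑ F ∈ K.faces with F.image κ ⊆ T, (-1 : ℤ) ^ #F := by
  have h1 : ∀ F, (-1 : ℤ) ^ #F * ∑ G ∈ K.openStar F, (-1 : ℤ) ^ #G =
      ∑ G ∈ K.faces, if F ⊆ G then (-1) ^ #F * (-1) ^ #G else 0 := by
    intro F
    rw [FinComplex.openStar, mul_sum, sum_filter]
  rw [sum_congr rfl (fun F _ => h1 F), sum_comm, sum_filter (s := K.faces)]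
  refine sum_congr rfl fun G hG => ?_
  rw [← sum_filter, filter_filter]
  -- For fixed `G`, the admissible `F` form the power set of the vertices of `G` coloured outside
  -- `T`; its alternating sum is zero unless there are no such vertices.
  have h2 : ({F ∈ K.faces | F.image κ ⊆ Tᶜ ∧ F ⊆ G} : Finset (Finset V)) =
      ({x ∈ G | κ x ∈ Tᶜ} : Finset V).powerset := by
    ext F
    simp only [mem_filter, mem_powerset, image_subset_iff]
    constructor
    · rintro ⟨-, h, h'⟩ x hx
      exact mem_filter.2 ⟨h' hx, h x hx⟩
    · intro h
      exact ⟨K.down_closed G hG F (h.trans (filter_subset _ _)),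
        fun x hx => (mem_filter.1 (h hx)).2, h.trans (filter_subset _ _)⟩
  rw [h2, ← sum_mul, sum_powerset_neg_one_pow_card]
  have h3 : ({x ∈ G | κ x ∈ Tᶜ} : Finset V) = ∅ ↔ G.image κ ⊆ T := by
    simp [filter_eq_empty_iff, image_subset_iff]
  simp only [h3, ite_mul, one_mul, zero_mul]

end FlagNumbers

/-! ### Signed counts on the cross-polytope -/

section CrossPolytope

variable {V : Type u} {d : ℕ}

/-- The face of the cross-polytope with vertices `φ (i, b)` that contains `φ (i, b)` if and only if
`g i = some b`. -/
def crossFace (φ : Fin d × Bool ↪ V) (g : Fin d → Option Bool) : Finset V :=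
  ({p | g p.1 = some p.2} : Finset (Fin d × Bool)).map φ

theorem apply_mem_crossFace (φ : Fin d × Bool ↪ V) (g : Fin d → Option Bool) (p : Fin d × Bool) :
    φ p ∈ crossFace φ g ↔ g p.1 = some p.2 := by
  simp [crossFace]

theorem crossFace_subset_iff (φ : Fin d × Bool ↪ V) (g g' : Fin d → Option Bool) :
    crossFace φ g ⊆ crossFace φ g' ↔ ∀ i, g i = none ∨ g' i = g i := by
  rw [crossFace, crossFace, map_subset_map]
  constructor
  · intro h i
    cases hg : g i with
    | none => exact Or.inl rfl
    | some b =>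
      have := h (show (i, b) ∈ _ by simp [hg])
      exact Or.inr (by simpa using this)
  · rintro h ⟨i, b⟩ hp
    simp only [mem_filter, mem_univ, true_and] at hp ⊢
    rcases h i with h | h
    · simp [h] at hp
    · rw [h, hp]

theorem crossFace_injective (φ : Fin d × Bool ↪ V) : Function.Injective (crossFace φ) := by
  intro g g' h
  funext i
  have h1 := (crossFace_subset_iff φ g g').1 h.subset i
  have h2 := (crossFace_subset_iff φ g' g).1 h.symm.subset i
  rcases h1 with h1 | h1
  · rcases h2 with h2 | h2
    · rw [h1, h2]
    · exact h2
  · exact h1.symm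

theorem pow_card_crossFace (φ : Fin d × Bool ↪ V) (g : Fin d → Option Bool) (x : ℤ) :
    x ^ #(crossFace φ g) = ∏ i, if g i = none then 1 else x := by
  rw [crossFace, card_map, ← prod_const, prod_filter, Fintype.prod_prod_type]
  refine prod_congr rfl fun i _ => ?_
  rcases h : g i with _ | _ | _ <;> simp [h]

theorem image_crossFace_subset_iff {n : ℕ} (φ : Fin d × Bool ↪ V) (g : Fin d → Option Bool)
    (κ : V → Fin n) (T : Finset (Fin n)) :
    (crossFace φ g).image κ ⊆ T ↔ ∀ i, ∀ b, g i = some b → κ (φ (i, b)) ∈ T := by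
  rw [image_subset_iff]
  constructor
  · intro h i b hb
    exact h _ ((apply_mem_crossFace φ g (i, b)).2 hb)
  · intro h x hx
    obtain ⟨⟨i, b⟩, hp, rfl⟩ := mem_map.1 hx
    exact h i b (by simpa using hp)

/-- A face chooses, independently on each axis, one of the two ends or neither. This coding turns
signed face counts into products over the axes. -/
theorem FinComplex.IsCrossPolytope.exists_faces_eq_image {K : FinComplex V}
    (hK : K.IsCrossPolytope d) :
    ∃ φ : Fin d × Bool ↪ V, K.faces = univ.map ⟨crossFace φ, crossFace_injective φ⟩ := by
  classical
  obtain ⟨φ, hφ⟩ := hK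
  refine ⟨φ, ?_⟩
  ext F
  rw [hφ, mem_map]
  constructor
  · rintro ⟨G, hG, rfl⟩
    refine ⟨fun i => if (i, true) ∈ G then some true else if (i, false) ∈ G then some false
      else none, mem_univ _, ?_⟩
    simp only [Function.Embedding.coeFn_mk, crossFace]
    congr 1
    ext ⟨i, b⟩
    have := hG i
    simp only [mem_filter, mem_univ, true_and]
    cases b <;> split_ifs <;> simp_all
  · rintro ⟨g, -, rfl⟩
    refine ⟨_, ?_, rfl⟩
    intro i
    simp only [mem_filter, mem_univ, true_and]
    rintro ⟨h1, h2⟩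
    simp [h1] at h2

/-- A weighted count of functions whose weight is a product of local weights. -/
theorem sum_prod_option (w : Fin d → Option Bool → ℤ) :
    ∑ g : Fin d → Option Bool, ∏ i, w i (g i) =
      ∏ i, (w i none + (w i (some true) + w i (some false))) := by
  rw [← Fintype.piFinset_univ, ← prod_univ_sum]
  refine prod_congr rfl fun i _ => ?_
  rw [Fintype.sum_option, Fintype.sum_bool]

/-- The `f`-polynomial of the cross-polytope. -/
theorem FinComplex.IsCrossPolytope.sum_pow_card {K : FinComplex V} (hK : K.IsCrossPolytope d)
    (x : ℤ) : ∑ F ∈ K.faces, x ^ #F = (1 + 2 * x) ^ d := by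
  obtain ⟨φ, hφ⟩ := hK.exists_faces_eq_image
  rw [hφ, sum_map]
  simp only [Function.Embedding.coeFn_mk, pow_card_crossFace]
  rw [sum_prod_option fun _ o => if o = none then 1 else x]
  simp [two_mul]

/-- Every axis contributes -1: an axis used by `F` has its end forced, and a free axis gives 1 - 1 -
1. -/
theorem FinComplex.IsCrossPolytope.sum_openStar {K : FinComplex V} (hK : K.IsCrossPolytope d)
    {F : Finset V} (hF : F ∈ K.faces) : ∑ G ∈ K.openStar F, (-1 : ℤ) ^ #G = (-1) ^ d := by
  classical
  obtain ⟨φ, hφ⟩ := hK.exists_faces_eq_image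
  rw [hφ] at hF
  obtain ⟨g, -, rfl⟩ := mem_map.1 hF
  rw [FinComplex.openStar, sum_filter, hφ, sum_map]
  simp only [Function.Embedding.coeFn_mk, pow_card_crossFace, crossFace_subset_iff]
  have : ∀ g' : Fin d → Option Bool,
      (if ∀ i, g i = none ∨ g' i = g i then ∏ i, (if g' i = none then (1 : ℤ) else -1) else 0) =
        ∏ i, if g i = none ∨ g' i = g i then (if g' i = none then (1 : ℤ) else -1) else 0 := by
    intro g'
    rw [prod_ite_zero]
    simp
  rw [sum_congr rfl fun g' _ => this g',
    sum_prod_option fun i o => if g i = none ∨ o = g i then (if o = none then (1 : ℤ) else -1) else 0]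
  rw [prod_congr rfl (g := fun _ => (-1 : ℤ)), prod_const, card_univ, Fintype.card_fin]
  intro i _
  rcases g i with _ | _ | _ <;> simp

/-- A proper colouring of the `d`-dimensional cross-polytope by `d` colours pairs antipodes. -/
theorem FinComplex.IsCrossPolytope.sum_image_subset {K : FinComplex V} (hK : K.IsCrossPolytope d)
    {κ : V → Fin d} (hκ : ∀ F ∈ K.faces, Set.InjOn κ F) (T : Finset (Fin d)) :
    ∑ F ∈ K.faces with F.image κ ⊆ T, (-1 : ℤ) ^ #F = (-1) ^ #T := by
  classical
  obtain ⟨φ, hφ⟩ := hK.exists_faces_eq_image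
  have hinj : ∀ ε : Fin d → Bool, Function.Injective fun i => κ (φ (i, ε i)) := by
    intro ε i j hij
    have hmem : crossFace φ (fun i => some (ε i)) ∈ K.faces := by
      rw [hφ]; exact mem_map.2 ⟨fun i => some (ε i), mem_univ _, rfl⟩
    have := hκ _ hmem (mem_coe.2 ((apply_mem_crossFace φ _ (i, ε i)).2 rfl))
      (mem_coe.2 ((apply_mem_crossFace φ _ (j, ε j)).2 rfl)) hij
    exact congrArg Prod.fst (φ.injective this)
  have hbij := Finite.injective_iff_bijective.1 (hinj fun _ => true)
  have hpair : ∀ i, κ (φ (i, false)) = κ (φ (i, true)) := by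
    intro i
    obtain ⟨j, hj⟩ := hbij.2 (κ (φ (i, false)))
    by_cases hij : j = i
    · subst hij; exact hj.symm
    · exfalso
      -- Switching only axis `i` to its other end yields a facet containing two vertices of the same
      -- colour, on the axes `i` and `j`.
      have := @hinj (Function.update (fun _ => true) i false) j i
        (by simpa [Function.update_of_ne hij] using hj)
      exact hij this
  rw [sum_filter, hφ, sum_map]
  simp only [Function.Embedding.coeFn_mk, pow_card_crossFace, image_crossFace_subset_iff]
  have : ∀ g : Fin d → Option Bool,
      (if ∀ i b, g i = some b → κ (φ (i, b)) ∈ T then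
        ∏ i, (if g i = none then (1 : ℤ) else -1) else 0) =
        ∏ i, if ∀ b, g i = some b → κ (φ (i, b)) ∈ T then
          (if g i = none then (1 : ℤ) else -1) else 0 := by
    intro g
    rw [prod_ite_zero]
    simp
  rw [sum_congr rfl fun g _ => this g,
    sum_prod_option fun i o => if ∀ b, o = some b → κ (φ (i, b)) ∈ T then
      (if o = none then (1 : ℤ) else -1) else 0]
  -- An axis whose colour is in `T` gives 1 - 1 - 1 = -1; any other axis must stay unused and gives
  -- 1.
  rw [prod_congr rfl (g := fun i => if κ (φ (i, true)) ∈ T then (-1 : ℤ) else 1)]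
  · rw [hbij.prod_comp (fun c => if c ∈ T then (-1 : ℤ) else 1), prod_ite_mem, univ_inter,
      prod_const]
  · intro i _
    have hi := hpair i
    by_cases h : κ (φ (i, true)) ∈ T <;> simp [hi, h]

end CrossPolytope

/-! ### Open stars and boundary of the stellar subdivision -/

namespace CrossPolytopalComplex

variable {V : Type u} {d : ℕ} (X : CrossPolytopalComplex V d)

theorem oldFace_subset_oldFace {F G : Finset V} : X.oldFace F ⊆ X.oldFace G ↔ F ⊆ G :=
  map_subset_map

theorem oldFace_injective : Function.Injective X.oldFace := map_injective _

theorem card_oldFace (F : Finset V) : #(X.oldFace F) = #F := card_map _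

theorem card_coneFace (C : X.cells) (F : Finset V) : #(X.coneFace C F) = #F + 1 := by
  rw [coneFace, card_cons, card_oldFace]

theorem inl_mem_coneFace {C : X.cells} {F : Finset V} {x : V} :
    Sum.inl x ∈ X.coneFace C F ↔ x ∈ F := by simp [coneFace, oldFace]

theorem inr_mem_coneFace {C C' : X.cells} {F : Finset V} :
    Sum.inr C' ∈ X.coneFace C F ↔ C' = C := by simp [coneFace, oldFace]

theorem inr_notMem_oldFace {C : X.cells} {F : Finset V} :
    Sum.inr C ∉ X.oldFace F := by simp [oldFace]

theorem inl_mem_oldFace {F : Finset V} {x : V} :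
    Sum.inl x ∈ X.oldFace F ↔ x ∈ F := by simp [oldFace]

theorem oldFace_subset_coneFace {C : X.cells} {F G : Finset V} :
    X.oldFace F ⊆ X.coneFace C G ↔ F ⊆ G := by
  constructor
  · intro h x hx
    exact X.inl_mem_coneFace.1 (h (X.inl_mem_oldFace.2 hx))
  · rintro h (x | x) hx
    · exact X.inl_mem_coneFace.2 (h (X.inl_mem_oldFace.1 hx))
    · exact absurd hx X.inr_notMem_oldFace

theorem coneFace_subset_coneFace {C C' : X.cells} {F G : Finset V} :
    X.coneFace C F ⊆ X.coneFace C' G ↔ C = C' ∧ F ⊆ G := by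
  constructor
  · intro h
    exact ⟨X.inr_mem_coneFace.1 (h (X.inr_mem_coneFace.2 rfl)),
      fun x hx => X.inl_mem_coneFace.1 (h (X.inl_mem_coneFace.2 hx))⟩
  · rintro ⟨rfl, h⟩ (x | x) hx
    · exact X.inl_mem_coneFace.2 (h (X.inl_mem_coneFace.1 hx))
    · exact X.inr_mem_coneFace.2 (X.inr_mem_coneFace.1 hx)

theorem not_coneFace_subset_oldFace {C : X.cells} {F G : Finset V} :
    ¬ X.coneFace C F ⊆ X.oldFace G := fun h =>
  X.inr_notMem_oldFace (h (X.inr_mem_coneFace.2 rfl))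

theorem mem_stellar {G : Finset (V ⊕ X.cells)} : G ∈ X.stellar.faces ↔
    (∃ F ∈ X.skel.faces, X.oldFace F = G) ∨ ∃ C : X.cells, ∃ F ∈ C.1.faces, X.coneFace C F = G := by
  simp [stellar]

theorem oldFace_mem_stellar {F : Finset V} (hF : F ∈ X.skel.faces) :
    X.oldFace F ∈ X.stellar.faces := X.mem_stellar.2 (Or.inl ⟨F, hF, rfl⟩)

theorem sum_stellar (f : Finset (V ⊕ X.cells) → ℤ) :
    ∑ G ∈ X.stellar.faces, f G = ∑ G ∈ X.skel.faces, f (X.oldFace G) +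
      ∑ C : X.cells, ∑ G ∈ C.1.faces, f (X.coneFace C G) := by
  classical
  rw [show X.stellar.faces = X.skel.faces.image X.oldFace ∪
      Finset.univ.biUnion fun C : X.cells => C.1.faces.image (X.coneFace C) by
    ext G; simp [X.mem_stellar]]
  rw [sum_union, sum_image X.oldFace_injective.injOn, sum_biUnion]
  · congr 1
    refine sum_congr rfl fun C _ => sum_image fun F _ G _ h => ?_
    exact ((X.coneFace_subset_coneFace.1 h.subset).2).antisymm
      (X.coneFace_subset_coneFace.1 h.symm.subset).2
  · intro C _ C' _ hCC'
    rw [Function.onFun, disjoint_left]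
    intro G hG hG'
    obtain ⟨F, -, rfl⟩ := mem_image.1 hG
    obtain ⟨F', -, h⟩ := mem_image.1 hG'
    exact hCC' (X.coneFace_subset_coneFace.1 h.symm.subset).1
  · rw [disjoint_left]
    intro G hG hG'
    obtain ⟨F, -, rfl⟩ := mem_image.1 hG
    obtain ⟨C, -, hC⟩ := mem_biUnion.1 hG'
    obtain ⟨F', -, h⟩ := mem_image.1 hC
    exact X.not_coneFace_subset_oldFace h.subset

-- The cone faces over a cell containing `F` form the open star of `F` in the boundary of that cell,
-- shifted by one vertex, so each such cell contributes -(-1)^d.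
open Classical in
theorem sum_openStar_oldFace (F : Finset V) :
    ∑ G ∈ X.stellar.openStar (X.oldFace F), (-1 : ℤ) ^ #G =
      ∑ G ∈ X.skel.openStar F, (-1 : ℤ) ^ #G -
        (-1) ^ d * (#{C ∈ X.cells | F ∈ C.faces} : ℤ) := by
  rw [FinComplex.openStar, sum_filter, X.sum_stellar]
  simp only [X.oldFace_subset_oldFace, X.oldFace_subset_coneFace, X.card_oldFace, X.card_coneFace]
  rw [FinComplex.openStar, ← sum_filter, sub_eq_add_neg]
  congr 1
  rw [univ_eq_attach, sum_attach X.cells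
    (fun C => ∑ G ∈ C.faces, if F ⊆ G then (-1 : ℤ) ^ (#G + 1) else 0)]
  rw [sum_congr rfl (g := fun C => if F ∈ C.faces then -(-1 : ℤ) ^ d else 0)]
  · rw [← sum_filter, sum_const, nsmul_eq_mul]; ring
  · intro C hC
    rw [← sum_filter]
    split_ifs with hF
    · have := (X.cell_crossPolytope C hC).sum_openStar hF
      rw [FinComplex.openStar] at this
      rw [← this, ← sum_neg_distrib]
      exact sum_congr rfl fun G _ => by ring
    · refine sum_eq_zero fun G hG => ?_
      rw [mem_filter] at hG
      exact absurd (C.down_closed G hG.1 F hG.2) hF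

/-- A face containing an apex has its whole open star in the cone over `C`. That the value is
nonzero keeps such faces out of the boundary. -/
theorem sum_openStar_coneFace {C : X.cells} {F : Finset V} (hF : F ∈ C.1.faces) :
    ∑ G ∈ X.stellar.openStar (X.coneFace C F), (-1 : ℤ) ^ #G = (-1) ^ (d + 1) := by
  classical
  rw [FinComplex.openStar, sum_filter, X.sum_stellar]
  simp only [X.not_coneFace_subset_oldFace, if_false, sum_const_zero, zero_add,
    X.coneFace_subset_coneFace, X.card_coneFace]
  rw [sum_eq_single C]
  · simp only [true_and]
    have := (X.cell_crossPolytope C.1 C.2).sum_openStar hF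
    rw [FinComplex.openStar] at this
    rw [← sum_filter, pow_succ, ← this, sum_mul]
    exact sum_congr rfl fun G _ => by ring
  · intro C' _ h
    exact sum_eq_zero fun G _ => if_neg fun h' => h h'.1.symm
  · intro h
    exact absurd (mem_univ C) h

variable {k : Type v} [Field k]

open Classical in
/-- Only faces of the skeleton lie in the boundary of the stellar subdivision. -/
theorem boundaryFaces_stellar :
    X.stellar.boundaryFaces k = (X.boundaryFaces k).image X.oldFace := by
  ext G
  simp only [FinComplex.boundaryFaces, boundaryFaces, mem_filter, mem_image]
  have h0 : ∀ F, X.oldFace F = ∅ ↔ F = ∅ := fun F => map_eq_empty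
  constructor
  · rintro ⟨hG, h⟩
    rcases X.mem_stellar.1 hG with ⟨F, hF, rfl⟩ | ⟨C, F, hF, rfl⟩
    · exact ⟨F, ⟨hF, by rwa [h0] at h⟩, rfl⟩
    · exfalso
      rcases h with h | h
      · have := X.card_coneFace C F
        rw [h] at this
        simp at this
      · have h1 := h.sum_neg_one_pow_card (X.stellar.isConvexFamily_openStar _)
        rw [X.sum_openStar_coneFace hF] at h1
        exact absurd h1 (pow_ne_zero _ (by norm_num))
  · rintro ⟨F, ⟨hF, h⟩, rfl⟩
    exact ⟨X.oldFace_mem_stellar hF, by rwa [h0]⟩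

open Classical in
theorem flagH_image_oldFace (A : Finset (Finset V)) (κ : V → Fin d) (T : Finset (Fin d)) :
    flagH (A.image X.oldFace) (X.stellarColoring κ) (T.map Fin.castSuccEmb) = flagH A κ T := by
  have himg : ∀ F, (X.oldFace F).image (X.stellarColoring κ) = (F.image κ).map Fin.castSuccEmb := by
    intro F
    ext c
    simp [oldFace, stellarColoring]
  rw [flagH_eq_sum, flagH_eq_sum, card_map, sum_filter, sum_image X.oldFace_injective.injOn,
    sum_filter]
  simp only [himg, map_subset_map, card_map]

variable {X}

-- The Euler sum of the open star in Γ is 0 at a face of Δ and (-1)^(d+1) at an interior face;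
-- adding back the contribution of the cones leaves that of the skeleton.
open Classical in
theorem IsStackedDecomposition.sum_openStar_skel {Δ : FinComplex V} {r : ℕ}
    (hX : X.IsStackedDecomposition k Δ r) {F : Finset V} (hF : F ∈ X.skel.faces) :
    ∑ G ∈ X.skel.openStar F, (-1 : ℤ) ^ #G =
      (-1) ^ d * ((#{C ∈ X.cells | F ∈ C.faces} : ℤ) - if F ∈ Δ.faces then 0 else 1) := by
  have h := X.sum_openStar_oldFace F
  have hbd : F ∈ Δ.faces ↔ F = ∅ ∨ IsAcyclic k (X.stellar.openStar (X.oldFace F)) := by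
    rw [← hX.2.1, boundaryFaces, mem_filter]
    simp [hF]
  have hconv := X.stellar.isConvexFamily_openStar (X.oldFace F)
  by_cases hFΔ : F ∈ Δ.faces
  · have h0 : ∑ G ∈ X.stellar.openStar (X.oldFace F), (-1 : ℤ) ^ #G = 0 := by
      rcases hbd.1 hFΔ with rfl | h'
      -- The empty face is in the boundary by convention; here the acyclicity of the whole ball
      -- takes the place of the local condition.
      · have : X.stellar.openStar (X.oldFace ∅) = X.stellar.faces := by
          simp [FinComplex.openStar, oldFace]
        rw [this]
        exact hX.1.2.1.sum_neg_one_pow_card X.stellar.isConvexFamily_faces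
      · exact h'.sum_neg_one_pow_card hconv
    rw [if_pos hFΔ]
    linarith
  · have hF' := not_or.1 fun h' => hFΔ (hbd.2 h')
    have hne : X.oldFace F ≠ ∅ := fun h' => hF'.1 (map_eq_empty.1 h')
    have h1 := ((hX.1.1.1 _ (X.oldFace_mem_stellar hF) hne).resolve_left
      hF'.2).sum_neg_one_pow_card hconv
    rw [h1, pow_succ] at h
    rw [if_neg hFΔ]
    linarith

theorem IsStackedDecomposition.subset_skel {Δ : FinComplex V} {r : ℕ}
    (hX : X.IsStackedDecomposition k Δ r) : Δ.faces ⊆ X.skel.faces := by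
  classical
  rw [← hX.2.1, boundaryFaces]
  exact filter_subset _ _

end CrossPolytopalComplex

/-! ### Face counts in dimension at most one -/

section SmallCardinality

variable {V : Type u}

theorem sum_card_of_card_le_two {A : Finset (Finset V)} (h0 : ∅ ∈ A) (hA : ∀ F ∈ A, #F ≤ 2)
    (f : ℕ → ℤ) :
    ∑ F ∈ A, f #F = f 0 + #(facesOfCard A 1) * f 1 + #(facesOfCard A 2) * f 2 := by
  rw [← sum_fiberwise_of_maps_to (g := fun F : Finset V => #F) (t := range 3)
    (fun F hF => mem_range.2 (Nat.lt_succ_of_le (hA F hF)))]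
  have h1 : ∀ n, ∑ F ∈ A with #F = n, f #F = #(facesOfCard A n) * f n := by
    intro n
    rw [sum_congr rfl (g := fun _ => f n) (fun F hF => by rw [(mem_filter.1 hF).2]),
      sum_const, nsmul_eq_mul, facesOfCard]
  have h2 : facesOfCard A 0 = {∅} := by
    ext F
    simp only [facesOfCard, mem_filter, card_eq_zero, mem_singleton]
    exact ⟨fun h => h.2, fun h => ⟨h ▸ h0, h⟩⟩
  simp only [h1, sum_range_succ, sum_range_zero, h2, card_singleton]
  ring

end SmallCardinality

/-! ### The case of a colouring proper on the skeleton -/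

namespace CrossPolytopalComplex

variable {V : Type u} {d : ℕ} {X : CrossPolytopalComplex V d} {k : Type v} [Field k]

open Classical in
/-- Exchange of summation between the cells and the faces of the skeleton. -/
theorem sum_mul_card_cells (X : CrossPolytopalComplex V d) (p : Finset V → Prop)
    [DecidablePred p] (f : Finset V → ℤ) :
    ∑ F ∈ X.skel.faces with p F, f F * (#{C ∈ X.cells | F ∈ C.faces} : ℤ) =
      ∑ C ∈ X.cells, ∑ F ∈ C.faces with p F, f F := by
  have h1 : ∀ F, f F * (#{C ∈ X.cells | F ∈ C.faces} : ℤ) =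
      ∑ C ∈ X.cells, if F ∈ C.faces then f F else 0 := by
    intro F
    rw [← sum_filter, sum_const, nsmul_eq_mul, mul_comm]
  rw [sum_congr rfl fun F _ => h1 F, sum_comm]
  refine sum_congr rfl fun C hC => ?_
  rw [← sum_filter, filter_filter]
  refine sum_congr ?_ fun _ _ => rfl
  ext F
  simp only [mem_filter]
  exact ⟨fun h => ⟨h.2.2, h.2.1⟩, fun h => ⟨X.cell_subset C hC h.1, h.2, h.1⟩⟩

/-- If `κ` is proper on the whole skeleton, the Dehn–Sommerville duality gives the flag `h`-numbers. -/
theorem IsStackedDecomposition.flagH_eq_card_cells_of_injOn {Δ : FinComplex V} {r : ℕ}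
    (hX : X.IsStackedDecomposition k Δ r) {κ : V → Fin d}
    (hκ : ∀ F ∈ X.skel.faces, Set.InjOn κ F) (hrd : r ≤ d) {T : Finset (Fin d)}
    (hT₁ : r - 1 ≤ #T) (hT₂ : #T ≤ d - r + 1) : flagH Δ.faces κ T = (#X.cells : ℤ) := by
  classical
  have hsmall : ∀ S : Finset (Fin d), #S ≤ d - r + 1 → ∀ F ∈ X.skel.faces, F.image κ ⊆ S →
      F ∈ Δ.faces := by
    intro S hS F hF hFS
    refine hX.2.2 F hF (le_trans ?_ hS)
    rw [← card_image_of_injOn (hκ F hF)]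
    exact card_le_card hFS
  have hcompl : #Tᶜ + #T = d := by
    rw [card_compl_add_card, Fintype.card_fin]
  have hsign : (-1 : ℤ) ^ d = (-1) ^ #Tᶜ * (-1) ^ #T := by rw [← pow_add, hcompl]
  have hΔ : ∑ F ∈ Δ.faces with F.image κ ⊆ T, (-1 : ℤ) ^ #F =
      ∑ F ∈ X.skel.faces with F.image κ ⊆ T, (-1 : ℤ) ^ #F := by
    refine sum_congr ?_ fun _ _ => rfl
    ext F
    simp only [mem_filter]
    exact ⟨fun h => ⟨hX.subset_skel h.1, h.2⟩, fun h => ⟨hsmall T hT₂ F h.1 h.2, h.2⟩⟩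
  rw [flagH_eq_sum_of_injOn (fun F hF => hκ F (hX.subset_skel hF)), hΔ,
    ← X.skel.sum_openStar_compl κ T]
  -- The lower bound on `#T` enters here: it gives `#Tᶜ ≤ d - r + 1`, so these faces lie in Δ.
  have hstar : ∀ F ∈ ({F ∈ X.skel.faces | F.image κ ⊆ Tᶜ} : Finset (Finset V)),
      (-1 : ℤ) ^ #F * ∑ G ∈ X.skel.openStar F, (-1 : ℤ) ^ #G =
        ((-1) ^ #F * (-1) ^ d) * (#{C ∈ X.cells | F ∈ C.faces} : ℤ) := by
    intro F hF
    rw [mem_filter] at hF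
    rw [hX.sum_openStar_skel hF.1, if_pos (hsmall Tᶜ (by omega) F hF.1 hF.2)]
    ring
  rw [sum_congr rfl hstar, X.sum_mul_card_cells (fun F => F.image κ ⊆ Tᶜ)
    fun F => (-1) ^ #F * (-1) ^ d]
  have hcell : ∀ C ∈ X.cells, ∑ F ∈ C.faces with F.image κ ⊆ Tᶜ, (-1 : ℤ) ^ #F * (-1) ^ d =
      (-1) ^ #T := by
    intro C hC
    rw [← sum_mul, (X.cell_crossPolytope C hC).sum_image_subset
      (fun F hF => hκ F (X.cell_subset C hC hF)), hsign, ← mul_assoc, ← mul_pow]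
    simp
  rw [sum_congr rfl hcell, sum_const, nsmul_eq_mul, mul_left_comm, ← mul_pow]
  simp

end CrossPolytopalComplex

/-! ### The polygon case r = d = 2 -/

/-- A polygon decomposed into `m` quadrangles without interior vertices has `2 m + 2` vertices. -/
theorem CrossPolytopalComplex.IsStackedDecomposition.card_vertices_polygon {V : Type u}
    {k : Type v} [Field k] {X : CrossPolytopalComplex V 2} {Δ : FinComplex V}
    (hX : X.IsStackedDecomposition k Δ 2) (hsph : Δ.IsHomologySphere k 2) :
    (#(facesOfCard Δ.faces 1) : ℤ) = 2 * #X.cells + 2 := by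
  classical
  have hsum := fun (K : FinComplex V) (hK : ∀ F ∈ K.faces, #F ≤ 2) =>
    sum_card_of_card_le_two K.empty_mem hK
  have hverts : facesOfCard Δ.faces 1 = facesOfCard X.skel.faces 1 := by
    ext F
    simp only [facesOfCard, mem_filter]
    exact ⟨fun h => ⟨hX.subset_skel h.1, h.2⟩, fun h => ⟨hX.2.2 F h.1 (by omega), h.2⟩⟩
  have hstar : ∀ K : FinComplex V, K.openStar ∅ = K.faces := fun K => by
    simp [FinComplex.openStar]
  -- the Euler characteristics of the circle and of the skeleton
  have h1 := hsph.sum_openStar Δ.empty_mem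
  rw [hstar, hsum Δ hsph.1.2 fun n => (-1) ^ n] at h1
  have h2 := hX.sum_openStar_skel X.skel.empty_mem
  rw [hstar, hsum X.skel X.skel_dim fun n => (-1) ^ n, if_pos Δ.empty_mem,
    filter_true_of_mem fun C _ => C.empty_mem] at h2
  -- every edge lies in one or two quadrangles
  have h3 : ∀ F ∈ facesOfCard X.skel.faces 2, (1 : ℤ) * #{C ∈ X.cells | F ∈ C.faces} =
      1 + if F ∈ Δ.faces then 0 else 1 := by
    intro F hF
    simp only [facesOfCard, mem_filter] at hF
    have h := hX.sum_openStar_skel hF.1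
    have hF' : X.skel.openStar F = {F} := by
      ext G
      simp only [FinComplex.openStar, mem_filter, mem_singleton]
      constructor
      · rintro ⟨hG, hFG⟩
        exact (eq_of_subset_of_card_le hFG (by rw [hF.2]; exact X.skel_dim G hG)).symm
      · rintro rfl
        exact ⟨hF.1, Subset.rfl⟩
    rw [hF', sum_singleton, hF.2] at h
    linarith
  have h4 : ∑ F ∈ facesOfCard X.skel.faces 2, (1 : ℤ) * #{C ∈ X.cells | F ∈ C.faces} =
      ∑ C ∈ X.cells, ∑ F ∈ C.faces with #F = 2, (1 : ℤ) :=
    X.sum_mul_card_cells (fun F => #F = 2) fun _ => 1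
  have h5 : ∀ C ∈ X.cells, ∑ F ∈ C.faces with #F = 2, (1 : ℤ) = 4 := by
    intro C hC
    have hdim : ∀ F ∈ C.faces, #F ≤ 2 := fun F hF => X.skel_dim F (X.cell_subset C hC hF)
    -- The values 9 and 1 of the f-polynomial at 1 and -1 determine the number of edges.
    have e1 := (X.cell_crossPolytope C hC).sum_pow_card 1
    have e2 := (X.cell_crossPolytope C hC).sum_pow_card (-1)
    rw [hsum C hdim fun n => 1 ^ n] at e1
    rw [hsum C hdim fun n => (-1) ^ n] at e2
    rw [sum_const, nsmul_eq_mul, mul_one, ← facesOfCard]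
    norm_num at e1 e2 ⊢
    linarith
  have h6 : (#{F ∈ facesOfCard X.skel.faces 2 | F ∈ Δ.faces} : ℤ) = #(facesOfCard Δ.faces 2) := by
    congr 2
    ext F
    simp only [facesOfCard, mem_filter]
    exact ⟨fun h => ⟨h.2, h.1.2⟩, fun h => ⟨⟨hX.subset_skel h.1, h.2⟩, h.1⟩⟩
  have h7 : ∑ F ∈ facesOfCard X.skel.faces 2, (1 + if F ∈ Δ.faces then (0 : ℤ) else 1) =
      ∑ F ∈ facesOfCard X.skel.faces 2, (2 - if F ∈ Δ.faces then (1 : ℤ) else 0) :=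
    sum_congr rfl fun F _ => by split_ifs <;> norm_num
  rw [sum_congr rfl h3, h7, sum_congr rfl h5, sum_sub_distrib, sum_boole, h6] at h4
  simp only [sum_const, nsmul_eq_mul] at h4
  -- With n vertices, e edges in the skeleton and e' in Δ: e' = n, 1 - n + e = m and 2e - e' = 4m,
  -- whence n = 2m + 2.
  rw [hverts] at h1 ⊢
  norm_num at h1 h2
  linarith

/-- Diagonals of the polygon need not be faces of Δ, so properness on them is not given and duality
is applied to the circle Δ instead: it makes the two colour classes equal in size. -/
theorem CrossPolytopalComplex.IsStackedDecomposition.flagH_eq_card_cells_polygon {V : Type u}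
    {k : Type v} [Field k] {X : CrossPolytopalComplex V 2} {Δ : FinComplex V}
    (hX : X.IsStackedDecomposition k Δ 2) (hsph : Δ.IsHomologySphere k 2) {κ : V → Fin 2}
    (hκ : ∀ F ∈ Δ.faces, Set.InjOn κ F) {T : Finset (Fin 2)} (hT : #T = 1) :
    flagH Δ.faces κ T = (#X.cells : ℤ) := by
  classical
  have hdual := Δ.sum_openStar_compl κ T
  rw [sum_congr rfl (g := fun F : Finset V => (-1 : ℤ) ^ #F) (fun F hF => by
    rw [hsph.sum_openStar (mem_filter.1 hF).1]; simp)] at hdual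
  have hcompl : #Tᶜ = 1 := by
    rw [card_compl, Fintype.card_fin, hT]
  have hcard : ∀ S : Finset (Fin 2), ∀ F ∈ Δ.faces, F.image κ ⊆ S → #F ≤ #S := by
    intro S F hF h
    rw [← card_image_of_injOn (hκ F hF)]
    exact card_le_card h
  -- The empty face is counted in both sums, each vertex in exactly one, and an edge, having two
  -- colours, in neither.
  have hadd : ∑ F ∈ Δ.faces with F.image κ ⊆ T, (-1 : ℤ) ^ #F +
      ∑ F ∈ Δ.faces with F.image κ ⊆ Tᶜ, (-1 : ℤ) ^ #F =
      ∑ F ∈ Δ.faces, (fun n : ℕ => if n = 0 then (2 : ℤ) else if n = 1 then -1 else 0) #F := by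
    rw [sum_filter, sum_filter, ← sum_add_distrib]
    refine sum_congr rfl fun F hF => ?_
    have h1 := hcard T F hF
    have h2 := hcard Tᶜ F hF
    rw [hT] at h1
    rw [hcompl] at h2
    rcases Nat.lt_or_ge 1 #F with h | h
    · rw [if_neg fun h' => by have := h1 h'; omega, if_neg fun h' => by have := h2 h'; omega]
      simp only
      rw [if_neg (by omega), if_neg (by omega), add_zero]
    · rcases Nat.le_one_iff_eq_zero_or_eq_one.1 h with h | h
      · rw [card_eq_zero] at h
        subst h
        simp
      · obtain ⟨x, rfl⟩ := card_eq_one.1 h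
        by_cases hx : κ x ∈ T <;> simp [hx]
  rw [hdual, sum_card_of_card_le_two Δ.empty_mem hsph.1.2
    (fun n : ℕ => if n = 0 then (2 : ℤ) else if n = 1 then -1 else 0), hX.card_vertices_polygon hsph] at hadd
  norm_num at hadd
  rw [flagH_eq_sum_of_injOn hκ, hT]
  linarith

/-! ### The theorem -/

theorem theorem5p7 {k : Type v} [Field k] {V : Type u} (d r : ℕ) (hr : 1 ≤ r) (hrd : r ≤ d)
    (Δ : FinComplex V) (κ : V → Fin d) (hbal : Δ.IsBalanced κ) (hsph : Δ.IsHomologySphere k d)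
    (X : CrossPolytopalComplex V d) (hX : X.IsStackedDecomposition k Δ r)
    (T : Finset (Fin d)) (hT₁ : r - 1 ≤ #T) (hT₂ : #T ≤ d - r + 1) :
    flagH Δ.faces κ T =
        flagH (X.stellar.boundaryFaces k) (X.stellarColoring κ) (T.map Fin.castSuccEmb) ∧
      flagH (X.stellar.boundaryFaces k) (X.stellarColoring κ) (T.map Fin.castSuccEmb) =
        (#X.cells : ℤ) := by
  classical
  have hmain : flagH Δ.faces κ T = (#X.cells : ℤ) := by
    by_cases hcase : d = 1 ∨ r < d
    · refine hX.flagH_eq_card_cells_of_injOn ?_ hrd hT₁ hT₂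
      intro F hF x hx y hy hxy
      by_contra hne
      have hpair : ({x, y} : Finset V) ⊆ F := by
        intro z hz
        rcases mem_insert.1 hz with rfl | hz
        · exact hx
        · rw [mem_singleton.1 hz]; exact hy
      have hcard : #({x, y} : Finset V) = 2 := card_pair hne
      have hle := (card_le_card hpair).trans (X.skel_dim F hF)
      -- If r < d then 2 ≤ d - r + 1, so the edge lies in Δ; if d = 1, `hle` excludes it.
      have hmem : ({x, y} : Finset V) ∈ Δ.faces :=
        hX.2.2 _ (X.skel.down_closed F hF _ hpair) (by omega)
      exact hne (hbal.2 _ hmem (by simp) (by simp) hxy)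
    -- Here r = d ≥ 2, and d - 1 ≤ `#T` ≤ 1 leaves only d = 2.
    · obtain ⟨rfl, rfl⟩ : r = 2 ∧ d = 2 := by omega
      exact hX.flagH_eq_card_cells_polygon hsph hbal.2 (by omega)
  have hbd : flagH (X.stellar.boundaryFaces k) (X.stellarColoring κ) (T.map Fin.castSuccEmb) =
      flagH Δ.faces κ T := by
    rw [X.boundaryFaces_stellar, X.flagH_image_oldFace, hX.2.1]
  exact ⟨hbd.symm, hbd.trans hmain⟩
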